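/- Let $A$ be a (not necessarily unital) $\mathrm{C}^*$-algebra. Let $N_2=\{x\in A : x\neq 0,\ x^2=0\}$ be the set of nilpotent elements of $A$ of order exactly two, and let $[A,A]$ denote the linear span of the commutators $[x,y]=xy-yx$ with $x,y\in A$. Then \[ \overline{\mathrm{span}(N_2)}=\overline{[A,A]}, \] where spans are complex linear and closures are in the norm. Moreover (as a restatement), a positive bounded linear functional $\varphi$ on $A$ is a trace, i.e. satisfies $\varphi(xy)=\varphi(yx)$ for all $x,y\in A$, if and only if $\varphi(x)=0$ for every $x\in N_2$. -/

import Mathlib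

namespace CStarLie

/-- The set `N₂` of nilpotent elements of order exactly two: nonzero `x` with `x² = 0`. -/
def N₂ (A : Type*) [NonUnitalCStarAlgebra A] : Set A :=
  {x | x ≠ 0 ∧ x * x = 0}

/-- `[X, Y]`: the linear span of the commutators `xy - yx` with `x ∈ X`, `y ∈ Y`. -/
def commSpan {A : Type*} [NonUnitalCStarAlgebra A] (X Y : Set A) : Submodule ℂ A :=
  Submodule.span ℂ {z | ∃ x ∈ X, ∃ y ∈ Y, z = x * y - y * x}

section
open scoped ComplexOrder

/-- A bounded functional is positive if it takes nonnegative (real) values on the positive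
elements of `A`, that is, on the elements of the form `a* a`. -/
def IsPositiveFunctional {A : Type*} [NonUnitalCStarAlgebra A] (φ : A →L[ℂ] ℂ) : Prop :=
  ∀ a : A, 0 ≤ φ (star a * a)

end

/-- A bounded trace: a positive bounded functional `φ` with `φ(xy) = φ(yx)` for all `x, y`. -/
def IsBoundedTrace {A : Type*} [NonUnitalCStarAlgebra A] (φ : A →L[ℂ] ℂ) : Prop :=
  IsPositiveFunctional φ ∧ ∀ x y : A, φ (x * y) = φ (y * x)

end CStarLie

/-!
Both inclusions between the closed spans are obtained by approximating single commutators and single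
square-zero elements.

*Square-zero elements are limits of commutators.* If `x * x = 0` and `a = star x * x`, then `a * x = 0`.
So every `e = g(a) * a` satisfies `e * x = 0`, that is `x * e = [x, e]`, and for
`g(t) = t / (t² + δ²)` the element `x * e` tends to `x` as `δ → 0`.

*Commutators are limits of sums of square-zero elements.* As the positive elements span `A`, it is enough
to treat `[b, x]` with `b ≥ 0`, in the unitization of `A`. If `g * f = 0`, then `f * x * g` has square
zero. Cut `b` into layers: `b = ∑ cᵢ` (`i ≥ 1`), where `cᵢ` is the function `t ↦ max 0 (min 1 (t - i + 1))`
of `b` and `c₀ = 1`. Then `cᵢ₊₁ * cᵢ = cᵢ₊₁`, and with `fᵢ = cᵢ - cᵢ₊₁` every `[cᵢ₊₁, x]` equals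
`fᵢ₊₁ * x * fᵢ - fᵢ * x * fᵢ₊₁` up to square-zero terms. The point is that the norm of
`∑ fᵢ₊₁ * x * fᵢ` is at most `‖x‖`, however many layers there are: averaging over signs `εᵢ = ±1` turns
this sum into a mean of the products `(∑ εᵢ fᵢ₊₁) * x * (∑ εᵢ fᵢ)`
(`norm_add_sum_bilin_le_of_signs`), whose outer factors are contractions because the `fᵢ` are
nonnegative with sum at most `1`. Therefore `[b, x]` lies within `2‖x‖` of the span of the
square-zero elements (`exists_mem_span_norm_commutator_sub_le`). This bound does not depend on `b`;
replacing `b` by a large multiple of itself and rescaling shows that the distance is `0`.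

The statement on functionals follows, since a bounded functional is tracial exactly if it
vanishes on the closed span of the commutators.
-/

/-! ### Averaging over signs and the layer functions -/

theorem sum_insert_update_smul {ι H : Type*} [DecidableEq ι] [AddCommGroup H] [Module ℝ H]
    {a : ι} {s : Finset ι} (ha : a ∉ s) (ε : ι → ℝ) (r : ℝ) (w : ι → H) :
    ∑ i ∈ insert a s, Function.update ε a r i • w i = r • w a + ∑ i ∈ s, ε i • w i := by
  rw [Finset.sum_insert ha, Function.update_self]
  congr 1
  refine Finset.sum_congr rfl fun i hi => ?_
  rw [Function.update_of_ne (ne_of_mem_of_not_mem hi ha)]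

open Finset in
/-- The diagonal sum `∑ β (uᵢ, vᵢ)` is the average over all choices of
signs of `β (∑ εᵢ uᵢ, ∑ εᵢ vᵢ)`, hence bounded by any common bound of the latter. The offsets `U`, `V`
make the induction on the index set possible. -/
theorem norm_add_sum_bilin_le_of_signs {ι E F G : Type*} [AddCommGroup E] [Module ℝ E]
    [AddCommGroup F] [Module ℝ F] [NormedAddCommGroup G] [NormedSpace ℝ G]
    (β : E →ₗ[ℝ] F →ₗ[ℝ] G) (u : ι → E) (v : ι → F) (C : ℝ) (s : Finset ι) :
    ∀ (U : E) (V : F),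
      (∀ ε : ι → ℝ, (∀ i, |ε i| ≤ 1) →
        ‖β (U + ∑ i ∈ s, ε i • u i) (V + ∑ i ∈ s, ε i • v i)‖ ≤ C) →
      ‖β U V + ∑ i ∈ s, β (u i) (v i)‖ ≤ C := by
  classical
  induction s using Finset.induction_on with
  | empty => intro U V h; simpa using h 0 (by simp)
  | insert a s ha ih =>
    intro U V h
    have key : ∀ r : ℝ, |r| ≤ 1 →
        ‖β (U + r • u a) (V + r • v a) + ∑ i ∈ s, β (u i) (v i)‖ ≤ C := by
      intro r hr
      refine ih _ _ fun ε hε => ?_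
      have := h (Function.update ε a r) fun i => by
        by_cases hi : i = a
        · subst hi; simpa using hr
        · simpa [Function.update_of_ne hi] using hε i
      rw [sum_insert_update_smul ha, sum_insert_update_smul ha] at this
      simpa [add_assoc] using this
    have h1 := key 1 (by simp)
    have h2 := key (-1) (by simp)
    have hsum : (2 : ℝ) • (β U V + ∑ i ∈ insert a s, β (u i) (v i)) =
        (β (U + (1 : ℝ) • u a) (V + (1 : ℝ) • v a) + ∑ i ∈ s, β (u i) (v i)) +
        (β (U + (-1 : ℝ) • u a) (V + (-1 : ℝ) • v a) + ∑ i ∈ s, β (u i) (v i)) := by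
      rw [sum_insert ha]
      simp only [map_add, map_smul, LinearMap.add_apply, LinearMap.smul_apply]
      module
    have h3 := norm_add_le_of_le h1 h2
    rw [← hsum, norm_smul, Real.norm_ofNat] at h3
    linarith

/-- The function cutting out the layer `[i - 1, i]` of the half-line: it vanishes up to `i - 1`, has slope
one on the layer, and equals one from `i` on. On `[0, ∞)` the function of index `0` is constant one. -/
def layer (i : ℕ) (t : ℝ) : ℝ := max 0 (min 1 (t - i + 1))

theorem continuous_layer (i : ℕ) : Continuous (layer i) := by
  unfold layer; fun_prop

theorem layer_zero {t : ℝ} (ht : 0 ≤ t) : layer 0 t = 1 := by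
  simp [layer, ht]

theorem layer_succ_le (i : ℕ) (t : ℝ) : layer (i + 1) t ≤ layer i t := by
  unfold layer
  gcongr
  simp

theorem layer_succ_mul (i : ℕ) (t : ℝ) : layer (i + 1) t * layer i t = layer (i + 1) t := by
  unfold layer
  push_cast
  rcases le_total t i with h | h
  · rw [max_eq_left (a := (0 : ℝ)) (b := min 1 (t - (i + 1) + 1)), zero_mul]
    exact (min_le_right _ _).trans (by linarith)
  · rw [min_eq_left (a := (1 : ℝ)) (b := t - i + 1) (by linarith)]
    simp

theorem sum_layer {t : ℝ} (ht : 0 ≤ t) (n : ℕ) :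
    ∑ i ∈ Finset.range n, layer (i + 1) t = min t n := by
  induction n with
  | zero => simp [ht]
  | succ n ih =>
    have hlayer : layer (n + 1) t = max 0 (min 1 (t - n)) := by
      rw [layer]; push_cast; ring_nf
    rw [Finset.sum_range_succ, ih, hlayer]
    push_cast
    rcases le_total t n with h | h
    · rw [min_eq_left h, min_eq_left (a := t) (b := (n : ℝ) + 1) (by linarith),
        max_eq_left ((min_le_right _ _).trans (by linarith)), add_zero]
    · rcases le_total t (n + 1) with h' | h'
      · rw [min_eq_right h, min_eq_left h', min_eq_right (by linarith), max_eq_right (by linarith)]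
        ring
      · rw [min_eq_right h, min_eq_right h', min_eq_left (by linarith)]
        simp

theorem abs_sum_smul_layer_sub_le {t : ℝ} (ht : 0 ≤ t) (k n : ℕ) {ε : ℕ → ℝ}
    (hε : ∀ i, |ε i| ≤ 1) :
    |∑ i ∈ Finset.range n, ε i * (layer (i + k) t - layer (i + k + 1) t)| ≤ 1 := by
  have hanti : Antitone fun i => layer i t := antitone_nat_of_succ_le fun i => layer_succ_le i t
  calc |∑ i ∈ Finset.range n, ε i * (layer (i + k) t - layer (i + k + 1) t)|
      ≤ ∑ i ∈ Finset.range n, |ε i * (layer (i + k) t - layer (i + k + 1) t)| :=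
        Finset.abs_sum_le_sum_abs _ _
    _ ≤ ∑ i ∈ Finset.range n, (layer (i + k) t - layer (i + k + 1) t) := by
        refine Finset.sum_le_sum fun i _ => ?_
        have h0 := sub_nonneg.2 (layer_succ_le (i + k) t)
        rw [abs_mul, abs_of_nonneg h0]
        exact mul_le_of_le_one_left h0 (hε i)
    _ = layer k t - layer (n + k) t := by
        have := Finset.sum_range_sub' (fun i => layer (i + k) t) n
        simp only [zero_add, add_right_comm _ 1 k] at this
        exact this
    _ ≤ 1 := by
        have h1 : layer k t ≤ layer 0 t := hanti (Nat.zero_le k)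
        have h2 : 0 ≤ layer (n + k) t := le_max_left _ _
        rw [layer_zero ht] at h1
        linarith

/-! ### Commutators with a positive element of a unital C⋆-algebra -/

section UnitalCStarAlgebra

variable {B : Type*} [CStarAlgebra B]

theorem norm_sum_smul_cfc_layer_sub_le {b : B} (hb : ∀ t ∈ spectrum ℝ b, 0 ≤ t) (k n : ℕ)
    {ε : ℕ → ℝ} (hε : ∀ i, |ε i| ≤ 1) :
    ‖∑ i ∈ Finset.range n, ε i • (cfc (layer (i + k)) b - cfc (layer (i + k + 1)) b)‖ ≤ 1 := by
  have hc := fun i => (continuous_layer i).continuousOn (s := spectrum ℝ b)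
  have : ∑ i ∈ Finset.range n, ε i • (cfc (layer (i + k)) b - cfc (layer (i + k + 1)) b) =
      cfc (∑ i ∈ Finset.range n, fun t => ε i • (layer (i + k) t - layer (i + k + 1) t)) b := by
    have hd := fun i j => (hc i).fun_sub (hc j)
    rw [cfc_sum _ _ _ fun i _ => (hd _ _).fun_const_smul (ε i)]
    refine Finset.sum_congr rfl fun i _ => ?_
    rw [cfc_smul _ _ _ (hd _ _), cfc_sub _ _ _ (hc _) (hc _)]
  rw [this]
  refine norm_cfc_le zero_le_one fun t ht => ?_
  simpa [Finset.sum_apply] using abs_sum_smul_layer_sub_le (hb t ht) k n hε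

/-- If `c 0 = 1` and each `c i` acts as a unit on `c (i + 1)`, the commutator of `c (i + 1)` with `x` is,
modulo elements `f * x * g` with `g * f = 0`, the off-diagonal commutator of the consecutive differences. -/
theorem commutator_sub_mem_span_of_mul_eq {c : ℕ → B}
    (hl : ∀ i, c (i + 1) * c i = c (i + 1)) (hr : ∀ i, c i * c (i + 1) = c (i + 1)) (x : B) (i : ℕ) :
    c (i + 1) * x - x * c (i + 1) -
        ((c (i + 1) - c (i + 2)) * x * (c i - c (i + 1)) -
          (c i - c (i + 1)) * x * (c (i + 1) - c (i + 2))) ∈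
      Submodule.span ℂ {z | ∃ f g : B, g * f = 0 ∧ z = f * x * g} := by
  have hl2 : c (i + 2) * c i = c (i + 2) := by
    rw [← hl (i + 1), mul_assoc, hl i]
  have hr2 : c i * c (i + 2) = c (i + 2) := by
    rw [← hr (i + 1), ← mul_assoc, hr i]
  have mem : ∀ f g : B, g * f = 0 →
      f * x * g ∈ Submodule.span ℂ {z | ∃ f g : B, g * f = 0 ∧ z = f * x * g} :=
    fun f g h => Submodule.subset_span ⟨f, g, h, rfl⟩
  have e : c (i + 1) * x - x * c (i + 1) -
        ((c (i + 1) - c (i + 2)) * x * (c i - c (i + 1)) -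
          (c i - c (i + 1)) * x * (c (i + 1) - c (i + 2))) =
      c (i + 1) * x * (1 - c i) + c (i + 2) * x * (c i - c (i + 1)) -
        (1 - c i) * x * c (i + 1) - (c i - c (i + 1)) * x * c (i + 2) := by
    noncomm_ring
  rw [e]
  refine sub_mem (sub_mem (add_mem (mem _ _ ?_) (mem _ _ ?_)) (mem _ _ ?_)) (mem _ _ ?_)
  · rw [sub_mul, one_mul, hr, sub_self]
  · rw [sub_mul, hr2, hr, sub_self]
  · rw [mul_sub, mul_one, hl, sub_self]
  · rw [mul_sub, hl2, hl, sub_self]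

/-- The commutator of a positive element `b` with `x` is within distance `2‖x‖` of the span of the
square-zero elements `f * x * g`, `g * f = 0`. The bound does not depend on `b`. -/
theorem exists_mem_span_norm_commutator_sub_le {b : B} (hsa : IsSelfAdjoint b)
    (hb : ∀ t ∈ spectrum ℝ b, 0 ≤ t) (x : B) :
    ∃ y ∈ Submodule.span ℂ {z | ∃ f g : B, g * f = 0 ∧ z = f * x * g},
      ‖b * x - x * b - y‖ ≤ 2 * ‖x‖ := by
  have hc := fun i => (continuous_layer i).continuousOn (s := spectrum ℝ b)
  obtain ⟨n, hn⟩ := exists_nat_ge (‖b‖ * ‖(1 : B)‖)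
  set c : ℕ → B := fun i => cfc (layer i) b with hcdef
  have hl : ∀ i, c (i + 1) * c i = c (i + 1) := fun i => by
    simp only [hcdef]
    rw [← cfc_mul _ _ _ (hc _) (hc _)]
    exact cfc_congr fun t _ => layer_succ_mul i t
  have hr : ∀ i, c i * c (i + 1) = c (i + 1) := fun i => by
    refine Eq.trans ?_ (hl i)
    exact cfc_commute_cfc (layer i) (layer (i + 1)) b
  have hsum : ∑ i ∈ Finset.range n, c (i + 1) = b := by
    simp only [hcdef]
    rw [← cfc_sum _ _ _ fun i _ => hc _]
    conv_rhs => rw [← cfc_id' ℝ b]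
    refine cfc_congr fun t ht => ?_
    have htn : t ≤ n :=
      (Real.le_norm_self t).trans ((spectrum.norm_le_norm_mul_of_mem ht).trans hn)
    simp only [Finset.sum_apply]
    rw [sum_layer (hb t ht), min_eq_left htn]
  let f : ℕ → B := fun i => c i - c (i + 1)
  -- Both families of products are bounded by averaging over signs.
  have bound : ∀ k l : ℕ, ‖∑ i ∈ Finset.range n, f (i + k) * x * f (i + l)‖ ≤ ‖x‖ := by
    intro k l
    have := norm_add_sum_bilin_le_of_signs ((LinearMap.mul ℝ B) ∘ₗ LinearMap.mulRight ℝ x)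
      (fun i => f (i + k)) (fun i => f (i + l)) ‖x‖ (Finset.range n) 0 0 fun ε hε => by
        have h1 := norm_sum_smul_cfc_layer_sub_le hb k n hε
        have h2 := norm_sum_smul_cfc_layer_sub_le hb l n hε
        simp only [zero_add, LinearMap.comp_apply, LinearMap.mulRight_apply, LinearMap.mul_apply']
        refine (norm_mul_le _ _).trans ?_
        refine (mul_le_of_le_one_right (norm_nonneg _) h2).trans ?_
        exact (norm_mul_le _ _).trans (mul_le_of_le_one_left (norm_nonneg _) h1)
    simpa using this
  refine ⟨∑ i ∈ Finset.range n, (c (i + 1) * x - x * c (i + 1) -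
    (f (i + 1) * x * f i - f i * x * f (i + 1))),
    sum_mem fun i _ => commutator_sub_mem_span_of_mul_eq hl hr x i, ?_⟩
  have e : b * x - x * b - ∑ i ∈ Finset.range n, (c (i + 1) * x - x * c (i + 1) -
      (f (i + 1) * x * f i - f i * x * f (i + 1))) =
      ∑ i ∈ Finset.range n, f (i + 1) * x * f i - ∑ i ∈ Finset.range n, f i * x * f (i + 1) := by
    simp only [Finset.sum_sub_distrib, ← Finset.sum_mul, ← Finset.mul_sum, hsum]
    abel
  rw [e]
  refine (norm_sub_le _ _).trans ?_
  have h1 := bound 1 0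
  have h2 := bound 0 1
  simp only [add_zero] at h1 h2
  linarith

end UnitalCStarAlgebra

/-! ### Square-zero elements and commutators without a unit -/

section NonUnitalCStarAlgebra

variable {A : Type*} [NonUnitalCStarAlgebra A]

open CStarLie

theorem mem_span_N₂_of_mul_self_eq_zero {x : A} (hx : x * x = 0) :
    x ∈ Submodule.span ℂ (N₂ A) := by
  by_cases h : x = 0
  · rw [h]; exact zero_mem _
  · exact Submodule.subset_span ⟨h, hx⟩

/-- `A` is an ideal of its unitization, so compressions `f * x * g` with `x ∈ A` and `g * f = 0` are
square-zero elements of `A`. -/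
theorem span_mul_inr_mul_le_map_span_N₂ (x : A) :
    Submodule.span ℂ {z | ∃ f g : Unitization ℂ A, g * f = 0 ∧ z = f * (x : Unitization ℂ A) * g} ≤
      (Submodule.span ℂ (N₂ A)).map (Unitization.inrHom ℂ ℂ A) := by
  rw [Submodule.span_le]
  rintro _ ⟨f, g, hgf, rfl⟩
  have hz : (((f * (x : Unitization ℂ A) * g).snd : A) : Unitization ℂ A) =
      f * (x : Unitization ℂ A) * g := by
    ext <;> simp
  refine ⟨(f * (x : Unitization ℂ A) * g).snd, mem_span_N₂_of_mul_self_eq_zero ?_, hz⟩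
  apply Unitization.inr_injective (R := ℂ)
  rw [Unitization.inr_mul, hz, Unitization.inr_zero]
  calc f * (x : Unitization ℂ A) * g * (f * (x : Unitization ℂ A) * g)
      = f * (x : Unitization ℂ A) * (g * f) * (x : Unitization ℂ A) * g := by noncomm_ring
    _ = 0 := by rw [hgf]; simp

theorem exists_mem_span_N₂_norm_commutator_sub_le (w x : A) :
    ∃ y ∈ Submodule.span ℂ (N₂ A),
      ‖star w * w * x - x * (star w * w) - y‖ ≤ 2 * ‖x‖ := by
  obtain ⟨y, hy, hle⟩ := exists_mem_span_norm_commutator_sub_le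
    (b := star (w : Unitization ℂ A) * (w : Unitization ℂ A)) (.star_mul_self _)
    spectrum_star_mul_self_nonneg (x : Unitization ℂ A)
  obtain ⟨y, hyA, rfl⟩ := span_mul_inr_mul_le_map_span_N₂ x hy
  refine ⟨y, hyA, ?_⟩
  rw [← Unitization.norm_inr (𝕜 := ℂ), ← Unitization.norm_inr (𝕜 := ℂ) x]
  simpa using hle

theorem star_mul_self_commutator_mem_closure_span_N₂ (w x : A) :
    star w * w * x - x * (star w * w) ∈ (Submodule.span ℂ (N₂ A)).topologicalClosure := by
  change _ ∈ closure (Submodule.span ℂ (N₂ A) : Set A)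
  rw [Metric.mem_closure_iff]
  intro δ hδ
  -- Scaling `w` by `r` multiplies the commutator by `r²` but keeps the bound `2‖x‖`.
  obtain ⟨r, hr1, hr⟩ : ∃ r : ℝ, 1 ≤ r ∧ 2 * ‖x‖ / δ < r :=
    ⟨max 1 (2 * ‖x‖ / δ + 1), le_max_left _ _, (lt_add_one _).trans_le (le_max_right _ _)⟩
  have hr0 : 0 < r := zero_lt_one.trans_le hr1
  obtain ⟨y, hy, hle⟩ := exists_mem_span_N₂_norm_commutator_sub_le ((r : ℂ) • w) x
  have hrc : ((r : ℂ) * r) ≠ 0 := by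
    have : (r : ℂ) ≠ 0 := by exact_mod_cast hr0.ne'
    exact mul_ne_zero this this
  refine ⟨((r : ℂ) * r)⁻¹ • y, Submodule.smul_mem _ _ hy, ?_⟩
  have e : star ((r : ℂ) • w) * ((r : ℂ) • w) * x - x * (star ((r : ℂ) • w) * ((r : ℂ) • w)) - y =
      ((r : ℂ) * r) • (star w * w * x - x * (star w * w) - ((r : ℂ) * r)⁻¹ • y) := by
    rw [smul_sub, smul_inv_smul₀ hrc, smul_sub, star_smul,
      show star (r : ℂ) = r from Complex.conj_ofReal r]
    simp only [smul_mul_assoc, mul_smul_comm, smul_smul]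
  rw [e, norm_smul] at hle
  simp only [norm_mul, Complex.norm_real, Real.norm_of_nonneg hr0.le] at hle
  rw [dist_eq_norm]
  rw [div_lt_iff₀ hδ] at hr
  have h0 := norm_nonneg (star w * w * x - x * (star w * w) - ((r : ℂ) * r)⁻¹ • y)
  by_contra! hcon
  nlinarith [mul_le_mul_of_nonneg_left hcon (mul_pos hr0 hr0).le,
    mul_le_mul_of_nonneg_right hr1 (mul_pos hr0 hδ).le]

theorem commutator_mem_closure_span_N₂ (a x : A) :
    a * x - x * a ∈ (Submodule.span ℂ (N₂ A)).topologicalClosure := by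
  let _ := CStarAlgebra.spectralOrder A
  have _ := CStarAlgebra.spectralOrderedRing A
  have ha : a ∈ Submodule.span ℂ {a : A | 0 ≤ a} := by
    rw [CStarAlgebra.span_nonneg]; trivial
  induction ha using Submodule.span_induction with
  | mem a ha =>
    obtain ⟨w, rfl⟩ := CStarAlgebra.nonneg_iff_eq_star_mul_self.1 (by simpa using ha)
    exact star_mul_self_commutator_mem_closure_span_N₂ w x
  | zero => simp
  | add a b _ _ iha ihb =>
    have : (a + b) * x - x * (a + b) = (a * x - x * a) + (b * x - x * b) := by noncomm_ring
    rw [this]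
    exact add_mem iha ihb
  | smul r a _ iha =>
    rw [smul_mul_assoc, mul_smul_comm, ← smul_sub]
    exact Submodule.smul_mem _ _ iha

/-- With `a = star x * x` and `g(t) = t / (t² + δ²)`, the square of the norm of `x - x * (g(a) * a)` is the
supremum over the spectrum of `t (δ² / (t² + δ²))²`, which is at most `δ`. -/
theorem norm_sub_mul_cfcₙ_mul_self_le (x : A) {δ : ℝ} (hδ : 0 < δ) :
    ‖x - x * (cfcₙ (fun t : ℝ => t / (t ^ 2 + δ ^ 2)) (star x * x) * (star x * x))‖ ^ 2 ≤ δ := by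
  set a := star x * x with ha
  have hsa : IsSelfAdjoint a := .star_mul_self x
  have hne : ∀ t : ℝ, t ^ 2 + δ ^ 2 ≠ 0 := fun t => by positivity
  have hg : Continuous fun t : ℝ => t / (t ^ 2 + δ ^ 2) :=
    continuous_id.div (by fun_prop) hne
  have he : cfcₙ (fun t : ℝ => t / (t ^ 2 + δ ^ 2)) a * a =
      cfcₙ (fun t : ℝ => t / (t ^ 2 + δ ^ 2) * t) a := by
    rw [cfcₙ_mul _ _ a hg.continuousOn (by simp) (continuousOn_id' _) rfl, cfcₙ_id' ℝ a]
  set h : ℝ → ℝ := fun t => t / (t ^ 2 + δ ^ 2) * t with hh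
  have hcont : Continuous h := hg.mul continuous_id
  have h0 : h 0 = 0 := by simp [hh]
  rw [he]
  set e := cfcₙ h a with hedef
  have hesa : star e = e := (cfcₙ_predicate h a : IsSelfAdjoint e)
  have hsq : star (x - x * e) * (x - x * e) =
      cfcₙ (fun t => (t - t * h t) - (h t * t - h t * (t * h t))) a := by
    have c1 : ContinuousOn (fun t : ℝ => t) (quasispectrum ℝ a) := continuousOn_id' _
    have c2 : ContinuousOn h (quasispectrum ℝ a) := hcont.continuousOn
    have c3 := c1.fun_mul c2
    have c4 := c2.fun_mul c1
    have c5 := c2.fun_mul c3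
    rw [cfcₙ_sub _ _ a (c1.fun_sub c3) (by simp) (c4.fun_sub c5) (by simp),
      cfcₙ_sub _ _ a c1 rfl c3 (by simp), cfcₙ_sub _ _ a c4 (by simp) c5 (by simp),
      cfcₙ_mul _ _ a c2 h0 c3 (by simp), cfcₙ_mul _ _ a c1 rfl c2 h0, cfcₙ_mul _ _ a c2 h0 c1 rfl,
      cfcₙ_id' ℝ a, ← hedef, star_sub, star_mul, hesa, ha]
    noncomm_ring
  rw [sq, ← CStarRing.norm_star_mul_self, hsq]
  refine norm_cfcₙ_le fun t _ => ?_
  have hp : 0 < t ^ 2 + δ ^ 2 := by positivity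
  have e1 : (t - t * h t) - (h t * t - h t * (t * h t)) = t * δ ^ 4 / (t ^ 2 + δ ^ 2) ^ 2 := by
    simp only [hh]
    field_simp
    ring
  rw [e1, Real.norm_eq_abs, abs_div, abs_mul, abs_of_pos (show 0 < δ ^ 4 by positivity),
    abs_of_pos (show 0 < (t ^ 2 + δ ^ 2) ^ 2 by positivity), div_le_iff₀ (by positivity)]
  have hs : t ^ 2 = |t| ^ 2 := (sq_abs t).symm
  rw [hs]
  have ht := abs_nonneg t
  have h1 : |t| * δ ≤ |t| ^ 2 + δ ^ 2 := by nlinarith [sq_nonneg (|t| - δ)]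
  have h2 : δ ^ 2 ≤ |t| ^ 2 + δ ^ 2 := by nlinarith
  calc |t| * δ ^ 4 = δ * ((|t| * δ) * δ ^ 2) := by ring
    _ ≤ δ * ((|t| ^ 2 + δ ^ 2) * (|t| ^ 2 + δ ^ 2)) := by gcongr
    _ = δ * (|t| ^ 2 + δ ^ 2) ^ 2 := by ring

theorem mem_closure_commSpan_of_mul_self_eq_zero {x : A} (hx : x * x = 0) :
    x ∈ (commSpan (Set.univ : Set A) (Set.univ : Set A)).topologicalClosure := by
  change _ ∈ closure (commSpan (Set.univ : Set A) (Set.univ : Set A) : Set A)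
  rw [Metric.mem_closure_iff]
  intro r hr
  have hle := norm_sub_mul_cfcₙ_mul_self_le x (δ := r ^ 2 / 2) (by positivity)
  set e := cfcₙ (fun t : ℝ => t / (t ^ 2 + (r ^ 2 / 2) ^ 2)) (star x * x) * (star x * x) with he
  have hex : e * x = 0 := by
    rw [he, mul_assoc, mul_assoc, hx, mul_zero, mul_zero]
  refine ⟨x * e, Submodule.subset_span ⟨x, trivial, e, trivial, by rw [hex, sub_zero]⟩, ?_⟩
  rw [dist_eq_norm]
  refine lt_of_pow_lt_pow_left₀ 2 hr.le (hle.trans_lt ?_)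
  have : 0 < r ^ 2 := by positivity
  linarith

theorem closure_span_N₂_eq_closure_commSpan (A : Type*) [NonUnitalCStarAlgebra A] :
    (Submodule.span ℂ (N₂ A)).topologicalClosure =
      (commSpan (Set.univ : Set A) (Set.univ : Set A)).topologicalClosure := by
  apply le_antisymm
  · refine Submodule.topologicalClosure_minimal _ (Submodule.span_le.2 fun x hx => ?_)
      (Submodule.isClosed_topologicalClosure _)
    exact mem_closure_commSpan_of_mul_self_eq_zero hx.2
  · refine Submodule.topologicalClosure_minimal _ (Submodule.span_le.2 ?_)
      (Submodule.isClosed_topologicalClosure _)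
    rintro _ ⟨a, -, x, -, rfl⟩
    exact commutator_mem_closure_span_N₂ a x

theorem topologicalClosure_span_le_ker_iff (φ : A →L[ℂ] ℂ) (S : Set A) :
    (Submodule.span ℂ S).topologicalClosure ≤ φ.ker ↔ ∀ x ∈ S, φ x = 0 := by
  constructor
  · exact fun h x hx => h (Submodule.le_topologicalClosure _ (Submodule.subset_span hx))
  · exact fun h => Submodule.topologicalClosure_minimal _ (Submodule.span_le.2 h) φ.isClosed_ker

end NonUnitalCStarAlgebra

theorem mainTheorem2 (A : Type*) [NonUnitalCStarAlgebra A] :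
    (Submodule.span ℂ (CStarLie.N₂ A)).topologicalClosure =
        (CStarLie.commSpan (Set.univ : Set A) (Set.univ : Set A)).topologicalClosure ∧
      ∀ φ : A →L[ℂ] ℂ, CStarLie.IsPositiveFunctional φ →
        (CStarLie.IsBoundedTrace φ ↔ ∀ x ∈ CStarLie.N₂ A, φ x = 0) := by
  refine ⟨closure_span_N₂_eq_closure_commSpan A, fun φ hφ => ?_⟩
  rw [← topologicalClosure_span_le_ker_iff, closure_span_N₂_eq_closure_commSpan,
    CStarLie.commSpan, topologicalClosure_span_le_ker_iff]
  constructor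
  · rintro ⟨-, h⟩ _ ⟨x, -, y, -, rfl⟩
    rw [map_sub, h, sub_self]
  · refine fun h => ⟨hφ, fun x y => ?_⟩
    rw [← sub_eq_zero, ← map_sub]
    exact h _ ⟨x, trivial, y, trivial, rfl⟩
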